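/- Let $G$ be a (finite-dimensional, Hausdorff, real smooth) Lie group of dimension $n$ with exponential map $\exp$, let $\partial_1,\dots,\partial_n$ be a basis of its Lie algebra $T_eG$, and let $X_i$ be the left-invariant vector field with $X_i(e)=\partial_i$. Let $J:G\to\mathbb{R}_{\ge 0}$ be smooth with $J(g^*)=0$ for some $g^*\in G$, such that on some neighborhood of $g^*$ the function $J$ is positive away from $g^*$ and has no local minimum other than $g^*$. Let $\bar\omega_1,\dots,\bar\omega_n>0$ be rational with $\bar\omega_i\neq\bar\omega_j$ and $2\bar\omega_i\ne\bar\omega_j$ for $i\neq j$, and $\bar\omega_i\neq\bar\omega_j+\bar\omega_k$ for distinct $i,j,k$. For $a=(a_1,\dots,a_n)$ and $\omega>0$ put $\omega_i=\omega\bar\omega_i$ and consider the extremum seeking vector field with exponential dither $$f(g,t)=-\sum_{i=1}^n a_i\sin(\omega_i t)\,J\Big(g\,\exp\Big(\sum_{j=1}^n a_j\sin(\omega_j t)\,\partial_j\Big)\Big)X_i(g)\in T_gG,$$ which in the time scale $\tau=\omega t$ becomes $\frac{dg}{d\tau}=\frac1\omega f(g,\tau/\omega)$. Then the signals $\sin(\bar\omega_i\tau)$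 have a common period $T>0$, and for every such $T$ the following holds. For all $a\in\mathbb{R}^n$, $\omega>0$ and $g\in G$, the map $\tau\mapsto\frac1\omega f(g,\tau/\omega)$ is continuous and $T$-periodic. There are functions $h_i(a,g)$, $i=1,\dots,n$, not depending on $\omega$, such that for all $a_1,\dots,a_n>0$, $\omega>0$, $g\in G$ the averaged vector field is $$\frac1T\int_0^T\frac1\omega f(g,\tau/\omega)\,d\tau=-\frac1\omega\sum_{i=1}^n\frac{a_i^2}{2}(X_iJ)(g)\,X_i(g)+\frac1\omega\sum_{i=1}^n h_i(a,g)\,X_i(g),$$ equivalently, in the original time scale, $$\frac{\omega}{T}\int_0^{T/\omega}f(g,t)\,dt=-\sum_{i=1}^n\frac{a_i^2}{2}(X_iJ)(g)\,X_i(g)+\sum_{i=1}^n h_i(a,g)\,X_i(g),$$ and $h_i(a,g)=O\big((\max_j a_j)^4\big)$ locally uniformly in $g$: for every compact $K\subset G$ there are $C\in\mathbb{R}$ and $r>0$ with $|h_i(a,g)|\le C(\max_j a_j)^4$ for all $i$, all $g\in K$ and all $a$ with $0<a_1,\dots,a_n\le r$. Moreover $\sum_{i=1}^n\frac{a_i^2}{2}(X_iJ)(g)=\frac12(X_aJ)(g)$,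 where $X_a$ is the left-invariant vector field with $X_a(e)=\sum_{i=1}^n a_i^2\,\partial_i$. -/

import Mathlib

open scoped Manifold ContDiff

namespace ExtremumSeeking

section Exponential

variable {E : Type*} [NormedAddCommGroup E] [NormedSpace ℝ E] [FiniteDimensional ℝ E]
  {G : Type*} [TopologicalSpace G] [ChartedSpace E G] [Group G] [LieGroup 𝓘(ℝ, E) ∞ G]
  [T2Space G]

/-- Every left-invariant vector field on a Lie group has a global integral curve through `1`. -/
theorem exists_oneParameter (v : GroupLieAlgebra 𝓘(ℝ, E) G) :
    ∃ γ : ℝ → G, γ 0 = 1 ∧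
      IsMIntegralCurve γ (mulInvariantVectorField v : (g : G) → TangentSpace 𝓘(ℝ, E) g) := by
  have : IsManifold 𝓘(ℝ, E) 1 G := IsManifold.of_le (n := ∞) (by simp)
  have : LieGroup 𝓘(ℝ, E) (minSmoothness ℝ 3) G :=
    LieGroup.of_le (n := ∞) (by
      rw [minSmoothness_of_isRCLikeNormedField]; exact WithTop.coe_le_coe.2 le_top)
  have hv : ContMDiff 𝓘(ℝ, E) 𝓘(ℝ, E).tangent 1
      (fun g : G ↦ (mulInvariantVectorField v g : TangentBundle 𝓘(ℝ, E) G)) :=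
    (contMDiff_mulInvariantVectorField v).of_le (by
      rw [minSmoothness_of_isRCLikeNormedField]; norm_num)
  have : CompleteSpace E := FiniteDimensional.complete ℝ E
  obtain ⟨γ, h0, hγ⟩ := exists_isMIntegralCurveAt_of_contMDiffAt_boundaryless (t₀ := 0)
    (hv.contMDiffAt (x := 1))
  obtain ⟨ε, hε, hγ⟩ := isMIntegralCurveAt_iff'.1 hγ
  refine exists_isMIntegralCurve_of_isMIntegralCurveOn hv hε (fun x ↦ ?_) 1
  refine ⟨fun t ↦ x * γ t, by simp [h0], ?_⟩
  rw [← Real.ball_zero_eq_Ioo]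
  intro t ht
  have hM (x y : G) : HasMFDerivAt 𝓘(ℝ, E) 𝓘(ℝ, E) (fun y : G ↦ x * y) y
      (mfderiv 𝓘(ℝ, E) 𝓘(ℝ, E) (fun y : G ↦ x * y) y) :=
    ((contMDiff_mul_left (n := ∞) (I := 𝓘(ℝ, E)) (a := x)).contMDiffAt.mdifferentiableAt
      (by simp)).hasMFDerivAt
  have key := (hM x (γ t)).comp_hasMFDerivWithinAt t (hγ t ht)
  refine key.congr_mfderiv ?_
  have e : mulInvariantVectorField v (x * γ t)
      = mfderiv 𝓘(ℝ, E) 𝓘(ℝ, E) (fun y : G ↦ x * y) (γ t) (mulInvariantVectorField v (γ t)) := by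
    have h1 : HasMFDerivAt 𝓘(ℝ, E) 𝓘(ℝ, E) (fun y : G ↦ x * y) (γ t * 1)
        (mfderiv 𝓘(ℝ, E) 𝓘(ℝ, E) (fun y : G ↦ x * y) (γ t)) := by
      have h := hM x (γ t * 1)
      rwa [mul_one (γ t)] at h ⊢
    have h2 := (HasMFDerivAt.comp (1 : G) h1 (hM (γ t) 1)).mfderiv
    have h3 : ((fun y : G ↦ x * y) ∘ fun y : G ↦ γ t * y) = fun y : G ↦ x * γ t * y := by
      ext y; simp [mul_assoc]
    rw [h3] at h2
    exact congrArg (fun L : E →L[ℝ] E ↦ L v) h2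
  refine ContinuousLinearMap.ext fun r ↦ ?_
  have e' := congrArg (fun z : E ↦ (show ℝ from r) • z) e
  refine Eq.trans ?_ e'.symm
  exact map_smul (mfderiv 𝓘(ℝ, E) 𝓘(ℝ, E) (fun y : G ↦ x * y) (γ t)) (show ℝ from r) _

/-- The exponential map of a Lie group: the time-one value of the integral curve through `1`
of the left-invariant vector field determined by `v`. -/
noncomputable def lieExp (v : GroupLieAlgebra 𝓘(ℝ, E) G) : G :=
  (exists_oneParameter v).choose 1

end Exponential

section Field

variable {E : Type*} [NormedAddCommGroup E] [NormedSpace ℝ E] [FiniteDimensional ℝ E]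
  {G : Type*} [TopologicalSpace G] [ChartedSpace E G] [Group G] [LieGroup 𝓘(ℝ, E) ∞ G]
  [T2Space G] {n : ℕ}

/-- The derivative `(X J)(g)` of `J` at `g` along the left-invariant vector field `X` with
`X(1) = v`. -/
noncomputable def leftDeriv (J : G → ℝ) (v : GroupLieAlgebra 𝓘(ℝ, E) G) (g : G) : ℝ :=
  mfderiv 𝓘(ℝ, E) 𝓘(ℝ, ℝ) J g (mulInvariantVectorField v g)

/-- The dither `∑ⱼ aⱼ sin(νⱼ t) ∂/∂gⱼ` in the Lie algebra. -/
noncomputable def dither (b : Module.Basis (Fin n) ℝ (GroupLieAlgebra 𝓘(ℝ, E) G))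
    (a ν : Fin n → ℝ) (t : ℝ) : GroupLieAlgebra 𝓘(ℝ, E) G :=
  ∑ j, (a j * Real.sin (ν j * t)) • b j

/-- The extremum seeking vector field
`f(g, t) = -∑ᵢ aᵢ sin(νᵢ t) J(g exp(∑ⱼ aⱼ sin(νⱼ t) ∂/∂gⱼ)) Xᵢ(g)`. -/
noncomputable def seekingField (J : G → ℝ)
    (b : Module.Basis (Fin n) ℝ (GroupLieAlgebra 𝓘(ℝ, E) G)) (a ν : Fin n → ℝ)
    (g : G) (t : ℝ) : TangentSpace 𝓘(ℝ, E) g :=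
  -∑ i, (a i * Real.sin (ν i * t) * J (g * lieExp (dither b a ν t))) •
    mulInvariantVectorField (b i) g

/-- The vector field governing `dg/dτ` in the time scale `τ = Ω t`, when `dg/dt = f(g, t)`. -/
noncomputable def timeScaled (Ω : ℝ) (f : (g : G) → ℝ → TangentSpace 𝓘(ℝ, E) g)
    (g : G) (τ : ℝ) : TangentSpace 𝓘(ℝ, E) g :=
  Ω⁻¹ • f g (τ / Ω)

/-- The average `(1/T) ∫₀ᵀ f(g, s) ds`, an integral in the finite-dimensional space `T_g G`
(whose underlying vector space is the model space `E`). -/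
noncomputable def averagedField (f : (g : G) → ℝ → TangentSpace 𝓘(ℝ, E) g) (T : ℝ)
    (g : G) : TangentSpace 𝓘(ℝ, E) g :=
  let F : ℝ → E := f g
  (T⁻¹ • ∫ s in (0 : ℝ)..T, F s : E)

/-- Assumption on the cost: `J ≥ 0` is smooth, vanishes at `gstar`, and on some neighborhood of
`gstar` it is positive away from `gstar` and has no other local minimum. -/
structure CostAssumption (J : G → ℝ) (gstar : G) : Prop where
  nonneg : ∀ g, 0 ≤ J g
  smooth : ContMDiff 𝓘(ℝ, E) 𝓘(ℝ, ℝ) ∞ J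
  zero : J gstar = 0
  posDef : ∃ U ∈ nhds gstar, ∀ g ∈ U, g ≠ gstar → 0 < J g ∧ ¬ IsLocalMin J g

end Field

/-- Assumption on the normalized (rational) dither frequencies `w`. -/
structure FrequencyAssumption {n : ℕ} (w : Fin n → ℚ) : Prop where
  pos : ∀ i, 0 < w i
  ne : ∀ i j, i ≠ j → w i ≠ w j
  two_mul_ne : ∀ i j, i ≠ j → 2 * w i ≠ w j
  ne_add : ∀ i j k, i ≠ j → i ≠ k → j ≠ k → w i ≠ w j + w k

/-- `T` is a common period of the normalized dither signals `sin(wᵢ τ)`. -/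
def IsCommonPeriod {n : ℕ} (w : Fin n → ℚ) (T : ℝ) : Prop :=
  0 < T ∧ ∀ i, Function.Periodic (fun τ : ℝ ↦ Real.sin ((w i : ℝ) * τ)) T

end ExtremumSeeking

namespace ExtremumSeeking

/-! ### One-parameter subgroups. -/

section OneParameter

variable {E : Type*} [NormedAddCommGroup E] [NormedSpace ℝ E]
  {G : Type*} [TopologicalSpace G] [ChartedSpace E G] [Group G] [LieGroup 𝓘(ℝ, E) ∞ G]

/-! In the time scale `τ` the averaged field has `X_i`-component `-m_i/ω`, where `m_i` is the mean
over a period of `a_i sin(ω̄_i τ) J(g exp v(τ))` and `v(τ)` is the dither. Take `h_i = a_i²/2 · X_i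
J - m_i`: the two averaging formulas then hold by rescaling time, and all the content lies in the
estimate `h_i = O(s⁴)`, with `s` a bound on the amplitudes.

The reflection `τ ↦ T - τ` changes the sign of every sine, hence of `v`. So `m_i` is unchanged when
`J(g exp v)` is replaced by half of `J(g exp v) - J(g exp (-v))`, and every term even in `v`, the
quadratic one included, drops out. Along `f(t) = J(g exp(tv))`, whose derivatives are iterated
derivatives along the left-invariant field of `v`, the odd part at `t = 1` equals `2 X_v J(g)` up to
a bound on `f'''`; this is cubic in the coefficients of `v`, uniformly for `g` in a compact set. The
linear term averages to `a_i²/2 · X_i J` by orthogonality of the sines, and the cubic remainder,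
multiplied by `a_i sin`, gives `s⁴`.

Continuity of `exp` enters twice, for the integrals and for the compactness behind the uniform
bound. It comes from parameter dependence of a flow near `1`, spread to the whole Lie algebra by
`exp(Nv) = exp(v)^N`. -/

theorem hasMFDerivAt_mul_left (x y : G) :
    HasMFDerivAt 𝓘(ℝ, E) 𝓘(ℝ, E) (fun y : G ↦ x * y) y
      (mfderiv 𝓘(ℝ, E) 𝓘(ℝ, E) (fun y : G ↦ x * y) y) :=
  ((contMDiff_mul_left (n := ∞) (I := 𝓘(ℝ, E)) (a := x)).contMDiffAt.mdifferentiableAt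
    (by simp)).hasMFDerivAt

/-- Chain rule at `1` for the composite of left translations by `y` and then by `x`. -/
theorem mulInvariantVectorField_mul (v : GroupLieAlgebra 𝓘(ℝ, E) G) (x y : G) :
    (mulInvariantVectorField v (x * y) : E)
      = mfderiv 𝓘(ℝ, E) 𝓘(ℝ, E) (fun y : G ↦ x * y) y (mulInvariantVectorField v y) := by
  have h1 : HasMFDerivAt 𝓘(ℝ, E) 𝓘(ℝ, E) (fun y : G ↦ x * y) (y * 1)
      (mfderiv 𝓘(ℝ, E) 𝓘(ℝ, E) (fun y : G ↦ x * y) y) := by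
    have h := hasMFDerivAt_mul_left (E := E) x (y * 1)
    rwa [mul_one y] at h ⊢
  have h2 := (HasMFDerivAt.comp (1 : G) h1 (hasMFDerivAt_mul_left y 1)).mfderiv
  have h3 : ((fun y : G ↦ x * y) ∘ fun z : G ↦ y * z) = fun z : G ↦ x * y * z := by
    ext z; simp [mul_assoc]
  rw [h3] at h2
  exact congrArg (fun L : E →L[ℝ] E ↦ L v) h2

/-- Left translates of integral curves of a left-invariant vector field are integral curves. -/
theorem isMIntegralCurve_mul_left {v : GroupLieAlgebra 𝓘(ℝ, E) G} {γ : ℝ → G}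
    (hγ : IsMIntegralCurve γ (mulInvariantVectorField v : (g : G) → TangentSpace 𝓘(ℝ, E) g))
    (x : G) :
    IsMIntegralCurve (fun t ↦ x * γ t)
      (mulInvariantVectorField v : (g : G) → TangentSpace 𝓘(ℝ, E) g) := by
  intro t
  have key := (hasMFDerivAt_mul_left (E := E) x (γ t)).comp t (hγ t)
  refine key.congr_mfderiv ?_
  refine ContinuousLinearMap.ext fun r ↦ ?_
  have e' := congrArg (fun z : E ↦ (show ℝ from r) • z) (mulInvariantVectorField_mul v x (γ t))
  refine Eq.trans ?_ e'.symm
  exact map_smul (mfderiv 𝓘(ℝ, E) 𝓘(ℝ, E) (fun y : G ↦ x * y) (γ t)) (show ℝ from r) _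

theorem contMDiff_two_mulInvariantVectorField (v : GroupLieAlgebra 𝓘(ℝ, E) G) :
    ContMDiff 𝓘(ℝ, E) 𝓘(ℝ, E).tangent 2
      (fun g : G ↦ (mulInvariantVectorField v g : TangentBundle 𝓘(ℝ, E) G)) := by
  have : LieGroup 𝓘(ℝ, E) (minSmoothness ℝ 3) G :=
    LieGroup.of_le (n := ∞) (by
      rw [minSmoothness_of_isRCLikeNormedField]; exact WithTop.coe_le_coe.2 le_top)
  simpa using contMDiff_mulInvariantVectorField (𝕜 := ℝ) (I := 𝓘(ℝ, E)) v

variable [FiniteDimensional ℝ E] [T2Space G]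

/-- The one-parameter subgroup with initial velocity `v`. -/
noncomputable def oneParameter (v : GroupLieAlgebra 𝓘(ℝ, E) G) : ℝ → G :=
  (exists_oneParameter v).choose

theorem oneParameter_zero (v : GroupLieAlgebra 𝓘(ℝ, E) G) : oneParameter v 0 = (1 : G) :=
  (exists_oneParameter v).choose_spec.1

theorem isMIntegralCurve_oneParameter (v : GroupLieAlgebra 𝓘(ℝ, E) G) :
    IsMIntegralCurve (oneParameter v)
      (mulInvariantVectorField v : (g : G) → TangentSpace 𝓘(ℝ, E) g) :=
  (exists_oneParameter v).choose_spec.2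

theorem oneParameter_one (v : GroupLieAlgebra 𝓘(ℝ, E) G) : oneParameter v 1 = lieExp v := rfl

/-- Uniqueness of integral curves. The functional equations of one-parameter subgroups follow by
checking that both sides solve the same initial value problem. -/
theorem eq_oneParameter {v : GroupLieAlgebra 𝓘(ℝ, E) G} {γ : ℝ → G} (h0 : γ 0 = 1)
    (hγ : IsMIntegralCurve γ (mulInvariantVectorField v : (g : G) → TangentSpace 𝓘(ℝ, E) g)) :
    γ = oneParameter v := by
  have : IsManifold 𝓘(ℝ, E) 1 G := IsManifold.of_le (n := ∞) (by simp)
  exact isMIntegralCurve_Ioo_eq_of_contMDiff_boundaryless (t₀ := 0)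
    ((contMDiff_two_mulInvariantVectorField v).of_le (by norm_num)) hγ
    (isMIntegralCurve_oneParameter v) (by rw [h0, oneParameter_zero])

theorem oneParameter_smul (s : ℝ) (v : GroupLieAlgebra 𝓘(ℝ, E) G) (t : ℝ) :
    oneParameter (s • v) t = oneParameter v (t * s) := by
  have h := (isMIntegralCurve_oneParameter v).comp_mul s
  rw [← mulInvariantVectorField_smul] at h
  exact (congrFun (eq_oneParameter (by simp [oneParameter_zero]) h) t).symm

theorem lieExp_smul (s : ℝ) (v : GroupLieAlgebra 𝓘(ℝ, E) G) :
    lieExp (s • v) = oneParameter v s := by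
  rw [← oneParameter_one, oneParameter_smul, one_mul]

theorem oneParameter_add (v : GroupLieAlgebra 𝓘(ℝ, E) G) (s t : ℝ) :
    oneParameter v (s + t) = oneParameter v s * oneParameter v t := by
  have h1 := (isMIntegralCurve_oneParameter v).comp_add s
  have h2 := isMIntegralCurve_mul_left h1 (oneParameter v s)⁻¹
  have h3 := congrFun (eq_oneParameter (by simp) h2) t
  rw [← h3]
  simp [add_comm]

theorem lieExp_nsmul (N : ℕ) (v : GroupLieAlgebra 𝓘(ℝ, E) G) :
    lieExp ((N : ℝ) • v) = lieExp v ^ N := by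
  rw [lieExp_smul, ← oneParameter_one]
  induction N with
  | zero => simp [oneParameter_zero]
  | succ k ih => rw [Nat.cast_succ, oneParameter_add, ih, pow_succ]

end OneParameter

/-! ### Integral curves in a chart and flows depending on a parameter. -/

section ChartField

open Set

variable {E : Type*} [NormedAddCommGroup E] [NormedSpace ℝ E]
  {M : Type*} [TopologicalSpace M] [ChartedSpace E M] [IsManifold 𝓘(ℝ, E) 1 M]

/-- A vector field read in the preferred chart at `x₀`. -/
noncomputable def chartField (x₀ : M) (V : (x : M) → TangentSpace 𝓘(ℝ, E) x) (y : E) : E :=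
  tangentCoordChange 𝓘(ℝ, E) ((extChartAt 𝓘(ℝ, E) x₀).symm y) x₀
    ((extChartAt 𝓘(ℝ, E) x₀).symm y) (V ((extChartAt 𝓘(ℝ, E) x₀).symm y))

theorem contDiffAt_chartField {x₀ : M} {V : (x : M) → TangentSpace 𝓘(ℝ, E) x}
    (hV : ContMDiffAt 𝓘(ℝ, E) 𝓘(ℝ, E).tangent 1
      (fun x ↦ (⟨x, V x⟩ : TangentBundle 𝓘(ℝ, E) M)) x₀) :
    ContDiffAt ℝ 1 (chartField x₀ V) (extChartAt 𝓘(ℝ, E) x₀ x₀) := by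
  rw [contMDiffAt_iff] at hV
  exact (hV.2.contDiffAt (range_mem_nhds_isInteriorPoint
    BoundarylessManifold.isInteriorPoint)).snd

/-- A solution of the differential equation in a chart yields an integral curve. -/
theorem hasMFDerivAt_extChartAt_symm_comp {x₀ : M} {V : (x : M) → TangentSpace 𝓘(ℝ, E) x}
    {f : ℝ → E} {t : ℝ} (hf : f t ∈ (extChartAt 𝓘(ℝ, E) x₀).target)
    (h : HasDerivAt f (chartField x₀ V (f t)) t) :
    HasMFDerivAt 𝓘(ℝ, ℝ) 𝓘(ℝ, E) ((extChartAt 𝓘(ℝ, E) x₀).symm ∘ f) t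
      ((1 : ℝ →L[ℝ] ℝ).smulRight (V ((extChartAt 𝓘(ℝ, E) x₀).symm (f t)))) := by
  set xₜ : M := (extChartAt 𝓘(ℝ, E) x₀).symm (f t)
  let z : E := V xₜ
  have h : HasDerivAt f (tangentCoordChange 𝓘(ℝ, E) xₜ x₀ xₜ z) t := h
  have hft1 : xₜ ∈ (extChartAt 𝓘(ℝ, E) x₀).source := (extChartAt 𝓘(ℝ, E) x₀).map_target hf
  have hft2 := mem_extChartAt_source (I := 𝓘(ℝ, E)) xₜ
  have key : HasDerivAt ((extChartAt 𝓘(ℝ, E) xₜ ∘ (extChartAt 𝓘(ℝ, E) x₀).symm) ∘ f) z t := by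
    rw [← tangentCoordChange_self (I := 𝓘(ℝ, E)) (x := xₜ) (z := xₜ) (v := z) hft2,
      ← tangentCoordChange_comp (x := x₀) ⟨⟨hft2, hft1⟩, hft2⟩]
    apply HasFDerivAt.comp_hasDerivAt _ _ h
    apply HasFDerivWithinAt.hasFDerivAt (s := range 𝓘(ℝ, E)) _ (by simp)
    rw [← (extChartAt 𝓘(ℝ, E) x₀).right_inv hf]
    exact hasFDerivWithinAt_tangentCoordChange ⟨hft1, hft2⟩
  have key' : HasFDerivAt ((extChartAt 𝓘(ℝ, E) xₜ ∘ (extChartAt 𝓘(ℝ, E) x₀).symm) ∘ f)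
      ((1 : ℝ →L[ℝ] ℝ).smulRight z) t := by
    refine key.hasFDerivAt.congr_fderiv ?_
    ext
    simp
  exact ⟨(continuousAt_extChartAt_symm'' hf).comp h.continuousAt, key'.hasFDerivWithinAt⟩

end ChartField

/-- Local flow of an autonomous `C¹` equation depending on a parameter: the solutions through a
fixed initial point depend jointly continuously on the parameter and the time. -/
theorem exists_parametric_flow {E C : Type*} [NormedAddCommGroup E] [NormedSpace ℝ E]
    [CompleteSpace E] [NormedAddCommGroup C] [NormedSpace ℝ C] [CompleteSpace C]
    {W : E × C → E} {x₀ : E} {c₀ : C} (hW : ContDiffAt ℝ 1 W (x₀, c₀)) :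
    ∃ x : C × ℝ → E, ∃ r > 0, ∃ ε > 0,
      ContinuousOn x (Metric.closedBall c₀ r ×ˢ Set.Icc (-ε) ε) ∧
      ∀ c ∈ Metric.closedBall c₀ r, x (c, 0) = x₀ ∧
        ∀ t ∈ Set.Ioo (-ε) ε, HasDerivAt (fun t ↦ x (c, t)) (W (x (c, t), c)) t := by
  -- The parameter becomes an extra state variable with zero velocity, so dependence on parameters
  -- reduces to dependence on initial values.
  have hF : ContDiffAt ℝ 1 (fun p : E × C ↦ (W p, (0 : C))) (x₀, c₀) := hW.prodMk contDiffAt_const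
  obtain ⟨ε, hε, a, r, L, K, hr, hPL⟩ := IsPicardLindelof.of_contDiffAt_one hF
  obtain ⟨α, hα, hcont⟩ :=
    (hPL 0).exists_forall_mem_closedBall_eq_hasDerivWithinAt_continuousOn
  simp only [zero_sub, zero_add] at hα hcont
  have hmem (c : C) (hc : c ∈ Metric.closedBall c₀ r) :
      (x₀, c) ∈ Metric.closedBall (x₀, c₀) (r : ℝ) := by
    rw [Metric.mem_closedBall] at hc ⊢
    simpa [Prod.dist_eq] using hc
  have hsnd (c : C) (hc : c ∈ Metric.closedBall c₀ r) (t : ℝ) (ht : t ∈ Set.Icc (-ε) ε) :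
      (α ((x₀, c), t)).2 = c := by
    obtain ⟨h0, hd⟩ := hα _ (hmem c hc)
    have hd2 : ∀ t ∈ Set.Icc (-ε) ε,
        HasDerivWithinAt (fun t ↦ (α ((x₀, c), t)).2) 0 (Set.Icc (-ε) ε) t := fun t ht ↦
      ((ContinuousLinearMap.snd ℝ E C).hasFDerivAt.comp_hasDerivWithinAt t (hd t ht))
    have h := (convex_Icc (-ε) ε).norm_image_sub_le_of_norm_hasDerivWithin_le (C := 0) hd2
      (by simp) (show (0 : ℝ) ∈ Set.Icc (-ε) ε by constructor <;> linarith) ht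
    simp only [zero_mul, norm_le_zero_iff, sub_eq_zero, h0] at h
    exact h
  refine ⟨fun q ↦ (α ((x₀, q.1), q.2)).1, r, hr, ε, hε, ?_, fun c hc ↦ ⟨?_, fun t ht ↦ ?_⟩⟩
  · refine continuous_fst.comp_continuousOn (hcont.comp (by fun_prop) fun q hq ↦ ?_)
    exact ⟨hmem q.1 hq.1, hq.2⟩
  · exact congrArg Prod.fst (hα _ (hmem c hc)).1
  · have h := ((hα _ (hmem c hc)).2 t (Set.Ioo_subset_Icc_self ht)).hasDerivAt
      (Icc_mem_nhds ht.1 ht.2)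
    have h2 := (ContinuousLinearMap.fst ℝ E C).hasFDerivAt.comp_hasDerivAt t h
    have e : α ((x₀, c), t) = ((α ((x₀, c), t)).1, c) :=
      Prod.ext rfl (hsnd c hc t (Set.Ioo_subset_Icc_self ht))
    refine h2.congr_deriv ?_
    change W (α ((x₀, c), t)) = _
    rw [e]

/-! ### Continuity of the exponential map. -/

section Continuity

variable {E : Type*} [NormedAddCommGroup E] [NormedSpace ℝ E]
  {G : Type*} [TopologicalSpace G] [ChartedSpace E G] [Group G] [LieGroup 𝓘(ℝ, E) ∞ G]
  {n : ℕ}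

/-- The map `v ↦ X_v(g)` as a linear map, where `X_v` is the left-invariant field with value `v`
at the identity. -/
noncomputable def leftInvariant (g : G) : GroupLieAlgebra 𝓘(ℝ, E) G →ₗ[ℝ] E where
  toFun v := mulInvariantVectorField v g
  map_add' v w := congrFun (mulInvariantVectorField_add v w) g
  map_smul' c v := congrFun (mulInvariantVectorField_smul c v) g

/-- The field is linear in the coefficients, so joint regularity reduces to that of the finitely
many fields of the `u i`. -/
theorem contDiffAt_chartField_sum [IsManifold 𝓘(ℝ, E) 1 G]
    (u : Fin n → GroupLieAlgebra 𝓘(ℝ, E) G) (c₀ : Fin n → ℝ) :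
    ContDiffAt ℝ 1 (fun p : E × (Fin n → ℝ) ↦
      chartField (1 : G) (mulInvariantVectorField (∑ i, p.2 i • u i)) p.1)
      (extChartAt 𝓘(ℝ, E) (1 : G) 1, c₀) := by
  have e : (fun p : E × (Fin n → ℝ) ↦
      chartField (1 : G) (mulInvariantVectorField (∑ i, p.2 i • u i)) p.1) =
      fun p ↦ ∑ i, p.2 i • chartField (1 : G) (mulInvariantVectorField (u i)) p.1 := by
    funext p
    let y := (extChartAt 𝓘(ℝ, E) (1 : G)).symm p.1
    change tangentCoordChange 𝓘(ℝ, E) y 1 y (leftInvariant y (∑ i, p.2 i • u i)) =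
      ∑ i, p.2 i • tangentCoordChange 𝓘(ℝ, E) y 1 y (leftInvariant y (u i))
    simp only [map_sum, map_smul]
  rw [e]
  refine ContDiffAt.sum fun i _ ↦ ContDiffAt.smul ?_ ?_
  · exact contDiffAt_pi.1 contDiffAt_snd i
  · have h := contDiffAt_chartField (x₀ := (1 : G)) (V := mulInvariantVectorField (u i))
      ((contMDiff_two_mulInvariantVectorField (u i)).of_le (by norm_num)).contMDiffAt
    exact ContDiffAt.comp (extChartAt 𝓘(ℝ, E) (1 : G) 1, c₀) h contDiffAt_fst

variable [FiniteDimensional ℝ E] [T2Space G]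

/-- The chart flow exists only for short times, whereas `exp` is a time-one value. For small `c` the
identity `exp(v) = γ_{v/s}(s)` trades time one for a short time `s`. -/
theorem eventually_continuousAt_lieExp (u : Fin n → GroupLieAlgebra 𝓘(ℝ, E) G) :
    ∀ᶠ c in nhds (0 : Fin n → ℝ), ContinuousAt (fun c ↦ lieExp (∑ i, c i • u i) : _ → G) c := by
  have : IsManifold 𝓘(ℝ, E) 1 G := IsManifold.of_le (n := ∞) (by simp)
  have : CompleteSpace E := FiniteDimensional.complete ℝ E
  set φ := extChartAt 𝓘(ℝ, E) (1 : G)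
  obtain ⟨x, r, hr, ε, hε, hcont, hx⟩ := exists_parametric_flow (contDiffAt_chartField_sum u 0)
  have hnhds : Metric.closedBall (0 : Fin n → ℝ) r ×ˢ Set.Icc (-ε) ε ∈ nhds (0, (0 : ℝ)) :=
    prod_mem_nhds (Metric.closedBall_mem_nhds _ hr) (Icc_mem_nhds (by linarith) hε)
  have hx0 : x (0, 0) = φ 1 := (hx 0 (Metric.mem_closedBall_self hr.le)).1
  have htgt : ∀ᶠ q in nhds ((0 : Fin n → ℝ), (0 : ℝ)), x q ∈ φ.target :=
    (hcont.continuousAt hnhds).eventually (by rw [hx0]; exact extChartAt_target_mem_nhds _)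
  obtain ⟨δ, hδ, hball⟩ := Metric.eventually_nhds_iff_ball.1
    (htgt.and (Filter.eventually_mem_set.2 hnhds))
  have hq (c : Fin n → ℝ) (hc : c ∈ Metric.ball 0 δ) (t : ℝ) (ht : t ∈ Set.Ioo (-δ) δ) :
      x (c, t) ∈ φ.target ∧ (c, t) ∈ Metric.closedBall (0 : Fin n → ℝ) r ×ˢ Set.Icc (-ε) ε := by
    refine hball _ ?_
    rw [← ball_prod_same, Real.ball_eq_Ioo]
    simpa using And.intro hc ht
  set δ' := min δ ε
  have hδ' : 0 < δ' := lt_min hδ hε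
  -- Up to time `δ` the chart solution stays in the chart's target, and up to `ε` it solves the
  -- equation; on the smaller window uniqueness identifies it with the one-parameter subgroup.
  have hcurve (c : Fin n → ℝ) (hc : c ∈ Metric.ball 0 δ) :
      Set.EqOn (fun t ↦ φ.symm (x (c, t))) (oneParameter (∑ i, c i • u i))
        (Set.Ioo (-δ') δ') := by
    have hcr := (hq c hc 0 ⟨by linarith, hδ⟩).2.1
    refine isMIntegralCurveOn_Ioo_eqOn_of_contMDiff_boundaryless (t₀ := 0) ⟨by linarith, hδ'⟩
      ((contMDiff_two_mulInvariantVectorField _).of_le (by norm_num)) ?_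
      ((isMIntegralCurve_oneParameter _).isMIntegralCurveOn _) ?_
    · intro t ht
      have h1 : t ∈ Set.Ioo (-δ) δ :=
        ⟨by linarith [ht.1, min_le_left δ ε], ht.2.trans_le (min_le_left _ _)⟩
      have h2 : t ∈ Set.Ioo (-ε) ε :=
        ⟨by linarith [ht.1, min_le_right δ ε], ht.2.trans_le (min_le_right _ _)⟩
      exact (hasMFDerivAt_extChartAt_symm_comp (f := fun t ↦ x (c, t)) (hq c hc t h1).1
        ((hx c hcr).2 t h2)).hasMFDerivWithinAt
    · simp only [(hx c hcr).1, oneParameter_zero]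
      exact extChartAt_to_inv (1 : G)
  set s := δ' / 2
  have hs : 0 < s := by positivity
  have hsδ : s < δ' := by simp only [s]; linarith
  have hsmall (c : Fin n → ℝ) (hc : c ∈ Metric.ball 0 (s * δ)) : s⁻¹ • c ∈ Metric.ball 0 δ := by
    rw [mem_ball_zero_iff] at hc ⊢
    rw [norm_smul, Real.norm_of_nonneg (by positivity), inv_mul_lt_iff₀ hs]
    exact hc
  have hform (c : Fin n → ℝ) (hc : c ∈ Metric.ball 0 (s * δ)) :
      (lieExp (∑ i, c i • u i) : G) = φ.symm (x (s⁻¹ • c, s)) := by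
    have h := hcurve _ (hsmall c hc) (show s ∈ Set.Ioo (-δ') δ' from ⟨by linarith, hsδ⟩)
    have e : ∑ i, c i • u i = s • ∑ i, (s⁻¹ • c) i • u i := by
      simp only [Finset.smul_sum, smul_smul, Pi.smul_apply, smul_eq_mul]
      simp [← mul_assoc, mul_inv_cancel₀ hs.ne']
    rw [e, lieExp_smul, ← h]
  filter_upwards [Metric.ball_mem_nhds (0 : Fin n → ℝ) (mul_pos hs hδ)] with c hc
  have hs' : s ∈ Set.Ioo (-δ) δ := ⟨by linarith, hsδ.trans_le (min_le_left _ _)⟩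
  have hev := Metric.isOpen_ball.mem_nhds hc
  refine ContinuousAt.congr (f := fun c ↦ φ.symm (x (s⁻¹ • c, s))) ?_
    (Filter.eventuallyEq_of_mem hev fun c hc ↦ (hform c hc).symm)
  have hcw : ContinuousOn (fun c : Fin n → ℝ ↦ x (s⁻¹ • c, s)) (Metric.ball 0 (s * δ)) :=
    hcont.comp (f := fun c : Fin n → ℝ ↦ (s⁻¹ • c, s)) (by fun_prop)
      fun c hc ↦ (hq _ (hsmall c hc) s hs').2
  exact ContinuousAt.comp (f := fun c : Fin n → ℝ ↦ x (s⁻¹ • c, s))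
    (continuousAt_extChartAt_symm'' (hq _ (hsmall c hc) s hs').1) (hcw.continuousAt hev)

/-- Write `exp(v) = exp(v/(N+1))^(N+1)` with `N` so large that the inner argument falls where
continuity is already known. -/
theorem continuous_lieExp_sum (u : Fin n → GroupLieAlgebra 𝓘(ℝ, E) G) :
    Continuous (fun c : Fin n → ℝ ↦ (lieExp (∑ i, c i • u i) : G)) := by
  have : ContinuousMul G := continuousMul_of_contMDiffMul 𝓘(ℝ, E) ∞
  rw [continuous_iff_continuousAt]
  intro c
  have hlim : Filter.Tendsto (fun N : ℕ ↦ ((N : ℝ) + 1)⁻¹ • c) Filter.atTop (nhds 0) := by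
    have h := (tendsto_one_div_add_atTop_nhds_zero_nat (𝕜 := ℝ)).smul_const c
    simpa using h
  obtain ⟨N, hN⟩ := (hlim.eventually (eventually_continuousAt_lieExp u)).exists
  have e : (fun c : Fin n → ℝ ↦ (lieExp (∑ i, c i • u i) : G)) =
      fun c ↦ lieExp (∑ i, (((N : ℝ) + 1)⁻¹ • c) i • u i) ^ (N + 1) := by
    funext c
    have hN0 : ((N : ℝ) + 1) ≠ 0 := by positivity
    rw [← lieExp_nsmul]
    congr 1
    simp only [Finset.smul_sum, smul_smul, Pi.smul_apply, smul_eq_mul, Nat.cast_succ]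
    simp [← mul_assoc, mul_inv_cancel₀ hN0]
  rw [e]
  exact (ContinuousAt.comp (x := c) (f := fun c ↦ ((N : ℝ) + 1)⁻¹ • c) hN
    (by fun_prop)).pow (N + 1)

end Continuity

/-- Odd Taylor expansion of order two, with the remainder controlled by the third derivative. -/
theorem abs_sub_sub_two_mul_deriv_le {f f₁ f₂ f₃ : ℝ → ℝ} {M : ℝ}
    (h₁ : ∀ t, HasDerivAt f (f₁ t) t) (h₂ : ∀ t, HasDerivAt f₁ (f₂ t) t)
    (h₃ : ∀ t, HasDerivAt f₂ (f₃ t) t) (hM : ∀ t ∈ Set.Icc (-1 : ℝ) 1, |f₃ t| ≤ M) :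
    |f 1 - f (-1) - 2 * f₁ 0| ≤ 2 * M := by
  have hM0 : 0 ≤ M := (abs_nonneg _).trans (hM 0 (by norm_num))
  have hneg {F F' : ℝ → ℝ} (h : ∀ t, HasDerivAt F (F' t) t) (t : ℝ) :
      HasDerivAt (fun t ↦ F (-t)) (-F' (-t)) t := by
    exact ((h (-t)).comp t (hasDerivAt_neg t)).congr_deriv (by ring)
  have mvt {F F' : ℝ → ℝ} (h : ∀ t, HasDerivAt F (F' t) t) {a b B : ℝ} (hab : a ≤ b)
      (hB : ∀ t ∈ Set.Icc a b, |F' t| ≤ B) : |F b - F a| ≤ B * (b - a) := by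
    have := (convex_Icc a b).norm_image_sub_le_of_norm_hasDerivWithin_le
      (fun t _ ↦ (h t).hasDerivWithinAt) hB (Set.left_mem_Icc.2 hab) (Set.right_mem_Icc.2 hab)
    simpa [abs_of_nonneg (sub_nonneg.2 hab)] using this
  -- Three mean value estimates in turn: for the odd part of `f₂`, the even part of `f₁` less its
  -- value at `0`, and the odd part of `f` less its linear term. The last two quantities vanish at
  -- `t = 0`, and each factor of length `t ≤ 1` is discarded.
  have b₂ : ∀ t ∈ Set.Icc (0 : ℝ) 1, |f₂ t - f₂ (-t)| ≤ 2 * M := fun t ht ↦ by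
    have h := mvt h₃ (a := -t) (b := t) (by linarith [ht.1]) fun s hs ↦
      hM s ⟨by linarith [hs.1, ht.2], by linarith [hs.2, ht.2]⟩
    nlinarith [ht.1, ht.2]
  have b₁ : ∀ t ∈ Set.Icc (0 : ℝ) 1, |f₁ t + f₁ (-t) - 2 * f₁ 0| ≤ 2 * M := fun t ht ↦ by
    have h := mvt (F := fun t ↦ f₁ t + f₁ (-t)) (fun t ↦ (h₂ t).add (hneg h₂ t)) ht.1
      fun s hs ↦ b₂ s ⟨hs.1, hs.2.trans ht.2⟩
    have e : f₁ t + f₁ (-t) - (f₁ 0 + f₁ (-0)) = f₁ t + f₁ (-t) - 2 * f₁ 0 := by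
      rw [neg_zero]; ring
    rw [e] at h
    nlinarith [ht.1, ht.2]
  have h := mvt (F := fun t ↦ f t - f (-t) - 2 * f₁ 0 * t)
    (F' := fun t ↦ f₁ t + f₁ (-t) - 2 * f₁ 0)
    (fun t ↦ by
      have h := ((h₁ t).sub (hneg h₁ t)).sub ((hasDerivAt_id t).const_mul (2 * f₁ 0))
      exact h.congr_deriv (by ring)) zero_le_one b₁
  have e : f 1 - f (-1) - 2 * f₁ 0 * 1 - (f 0 - f (-0) - 2 * f₁ 0 * 0)
      = f 1 - f (-1) - 2 * f₁ 0 := by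
    rw [neg_zero]; ring
  rw [e] at h
  linarith

/-! ### Iterated left-invariant derivatives and the odd part of the cost. -/

section LeftDeriv

variable {E : Type*} [NormedAddCommGroup E] [NormedSpace ℝ E]
  {G : Type*} [TopologicalSpace G] [ChartedSpace E G] [Group G] {n : ℕ}

theorem leftDeriv_sum (J : G → ℝ) (c : Fin n → ℝ) (u : Fin n → GroupLieAlgebra 𝓘(ℝ, E) G)
    (g : G) : leftDeriv J (∑ i, c i • u i) g = ∑ i, c i * leftDeriv J (u i) g := by
  let D : E →L[ℝ] ℝ := mfderiv 𝓘(ℝ, E) 𝓘(ℝ, ℝ) J g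
  change D (leftInvariant g (∑ i, c i • u i)) = ∑ i, c i * D (leftInvariant g (u i))
  simp only [map_sum, map_smul, smul_eq_mul]

theorem leftDeriv_sum_mul {ι : Type} (s : Finset ι) (c : ι → ℝ) {F : ι → G → ℝ} {g : G}
    (hF : ∀ i ∈ s, MDifferentiableAt 𝓘(ℝ, E) 𝓘(ℝ, ℝ) (F i) g) (v : GroupLieAlgebra 𝓘(ℝ, E) G) :
    leftDeriv (fun g ↦ ∑ i ∈ s, c i * F i g) v g = ∑ i ∈ s, c i * leftDeriv (F i) v g := by
  have h : HasMFDerivAt 𝓘(ℝ, E) 𝓘(ℝ, ℝ) (∑ i ∈ s, c i • F i) g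
      (∑ i ∈ s, c i • (show E →L[ℝ] ℝ from mfderiv 𝓘(ℝ, E) 𝓘(ℝ, ℝ) (F i) g)) :=
    HasMFDerivAt.sum fun i hi ↦ (hF i hi).hasMFDerivAt.const_smul (c i)
  have e : (fun g ↦ ∑ i ∈ s, c i * F i g) = ∑ i ∈ s, c i • F i := by
    funext g; simp
  rw [e, leftDeriv, h.mfderiv]
  change (∑ i ∈ s, c i • (show E →L[ℝ] ℝ from mfderiv 𝓘(ℝ, E) 𝓘(ℝ, ℝ) (F i) g))
    (leftInvariant g v) = _
  rw [sum_apply]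
  rfl

variable [LieGroup 𝓘(ℝ, E) ∞ G]

/-- The derivative is the fibre component of the tangent map of `J` composed with the field. One
order is lost on `J`; the bound `k ≤ 2` is the regularity established for the field. -/
theorem contMDiff_leftDeriv {J : G → ℝ} {k m : WithTop ℕ∞} (hk : k ≤ 2) (hkm : k + 1 ≤ m)
    (hJ : ContMDiff 𝓘(ℝ, E) 𝓘(ℝ, ℝ) m J) (v : GroupLieAlgebra 𝓘(ℝ, E) G) :
    ContMDiff 𝓘(ℝ, E) 𝓘(ℝ, ℝ) k (leftDeriv J v) := by
  have : IsManifold 𝓘(ℝ, E) 1 G := IsManifold.of_le (n := ∞) (by simp)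
  have h1 := (hJ.contMDiff_tangentMap hkm).comp
    ((contMDiff_two_mulInvariantVectorField v).of_le hk)
  exact (contMDiff_snd_tangentBundle_modelSpace ℝ 𝓘(ℝ, ℝ)).comp h1

/-- The third derivative is a cubic form in `c` whose coefficients, the triple derivatives along the
`u i`, are continuous and hence bounded on `S`. -/
theorem exists_abs_leftDeriv_three_le {J : G → ℝ} (hJ : ContMDiff 𝓘(ℝ, E) 𝓘(ℝ, ℝ) 3 J)
    (u : Fin n → GroupLieAlgebra 𝓘(ℝ, E) G) {S : Set G} (hS : IsCompact S) :
    ∃ M : ℝ, ∀ (c : Fin n → ℝ) (s : ℝ), (∀ i, |c i| ≤ s) → ∀ g ∈ S,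
      |leftDeriv (leftDeriv (leftDeriv J (∑ i, c i • u i)) (∑ i, c i • u i)) (∑ i, c i • u i) g|
        ≤ M * s ^ 3 := by
  have h₁ (i) := contMDiff_leftDeriv (k := 2) (m := 3) le_rfl (by norm_num) hJ (u i)
  have h₂ (i j) := contMDiff_leftDeriv (k := 1) (by norm_num) (by norm_num) (h₁ i) (u j)
  have h₃ (i j k) := contMDiff_leftDeriv (k := 0) (by norm_num) (by norm_num) (h₂ i j) (u k)
  choose B hB using fun i j k ↦ hS.exists_bound_of_continuousOn (h₃ i j k).continuous.continuousOn
  refine ⟨∑ k, ∑ j, ∑ i, B i j k, fun c s hc g hg ↦ ?_⟩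
  have e₁ : leftDeriv J (∑ i, c i • u i) = fun g ↦ ∑ i, c i * leftDeriv J (u i) g :=
    funext fun g ↦ leftDeriv_sum J c u g
  have e₂ : leftDeriv (leftDeriv J (∑ i, c i • u i)) (∑ i, c i • u i) =
      fun g ↦ ∑ j, c j * ∑ i, c i * leftDeriv (leftDeriv J (u i)) (u j) g := funext fun g ↦ by
    rw [leftDeriv_sum, e₁]
    refine Finset.sum_congr rfl fun j _ ↦ ?_
    rw [leftDeriv_sum_mul _ _ fun i _ ↦ (h₁ i).mdifferentiableAt (by norm_num)]
  have hd (i j) : MDifferentiable 𝓘(ℝ, E) 𝓘(ℝ, ℝ) (leftDeriv (leftDeriv J (u i)) (u j)) :=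
    (h₂ i j).mdifferentiable (by norm_num)
  have e₃ : leftDeriv (leftDeriv (leftDeriv J (∑ i, c i • u i)) (∑ i, c i • u i))
      (∑ i, c i • u i) g = ∑ k, ∑ j, ∑ i, c k * (c j * (c i *
        leftDeriv (leftDeriv (leftDeriv J (u i)) (u j)) (u k) g)) := by
    rw [leftDeriv_sum, e₂]
    refine Finset.sum_congr rfl fun k _ ↦ ?_
    -- Flattening the double sum to pairs allows one application of linearity.
    have e : (fun g ↦ ∑ j, c j * ∑ i, c i * leftDeriv (leftDeriv J (u i)) (u j) g) =
        fun g ↦ ∑ p : Fin n × Fin n, (c p.1 * c p.2) *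
          leftDeriv (leftDeriv J (u p.2)) (u p.1) g := funext fun g ↦ by
      simp only [Fintype.sum_prod_type, Finset.mul_sum, mul_assoc]
    rw [e, leftDeriv_sum_mul _ _ fun p _ ↦ hd p.2 p.1 g]
    simp only [Fintype.sum_prod_type, Finset.mul_sum, mul_assoc]
  rw [e₃, Finset.sum_mul]
  refine (Finset.abs_sum_le_sum_abs _ _).trans (Finset.sum_le_sum fun k _ ↦ ?_)
  rw [Finset.sum_mul]
  refine (Finset.abs_sum_le_sum_abs _ _).trans (Finset.sum_le_sum fun j _ ↦ ?_)
  rw [Finset.sum_mul]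
  refine (Finset.abs_sum_le_sum_abs _ _).trans (Finset.sum_le_sum fun i _ ↦ ?_)
  have hs : 0 ≤ s := (abs_nonneg _).trans (hc i)
  have hBg := hB i j k g hg
  rw [Real.norm_eq_abs] at hBg
  rw [abs_mul, abs_mul, abs_mul]
  calc _ ≤ s * (s * (s * B i j k)) := by
        gcongr
        exacts [hc k, hc j, hc i]
    _ = B i j k * s ^ 3 := by ring

variable [FiniteDimensional ℝ E] [T2Space G]

theorem hasDerivAt_comp_mul_oneParameter {J : G → ℝ} (hJ : MDifferentiable 𝓘(ℝ, E) 𝓘(ℝ, ℝ) J)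
    (g : G) (v : GroupLieAlgebra 𝓘(ℝ, E) G) (t : ℝ) :
    HasDerivAt (fun t ↦ J (g * oneParameter v t)) (leftDeriv J v (g * oneParameter v t)) t := by
  have h := (hJ (g * oneParameter v t)).hasMFDerivAt.comp t
    (isMIntegralCurve_mul_left (isMIntegralCurve_oneParameter v) g t)
  let D : E →L[ℝ] ℝ := mfderiv 𝓘(ℝ, E) 𝓘(ℝ, ℝ) J (g * oneParameter v t)
  have h' : HasFDerivAt (fun t ↦ J (g * oneParameter v t))
      (D.comp ((1 : ℝ →L[ℝ] ℝ).smulRight (leftInvariant (g * oneParameter v t) v))) t :=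
    hasMFDerivAt_iff_hasFDerivAt.1 h
  refine h'.hasDerivAt.congr_deriv ?_
  change D ((1 : ℝ) • leftInvariant (g * oneParameter v t) v) = _
  rw [one_smul]
  rfl

/-- Odd Taylor expansion of `t ↦ J(g exp(tv))` between `-1` and `1`. -/
theorem exists_abs_odd_part_le {J : G → ℝ} (hJ : ContMDiff 𝓘(ℝ, E) 𝓘(ℝ, ℝ) 3 J)
    (u : Fin n → GroupLieAlgebra 𝓘(ℝ, E) G) {K : Set G} (hK : IsCompact K) :
    ∃ M : ℝ, ∀ (c : Fin n → ℝ) (s : ℝ), s ≤ 1 → (∀ i, |c i| ≤ s) → ∀ g ∈ K,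
      |J (g * lieExp (∑ i, c i • u i)) - J (g * lieExp (∑ i, (-c i) • u i))
        - 2 * leftDeriv J (∑ i, c i • u i) g| ≤ M * s ^ 3 := by
  have : ContinuousMul G := continuousMul_of_contMDiffMul 𝓘(ℝ, E) ∞
  -- This compact set contains all `g exp(tv)` with `g ∈ K`, `|t| ≤ 1` and coefficients at most `1`;
  -- hence the requirement `s ≤ 1`.
  have hS : IsCompact ((fun p : G × (Fin n → ℝ) ↦ p.1 * lieExp (∑ i, p.2 i • u i)) ''
      (K ×ˢ Metric.closedBall 0 1)) :=
    (hK.prod (isCompact_closedBall 0 1)).image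
      (continuous_fst.mul ((continuous_lieExp_sum u).comp continuous_snd))
  obtain ⟨M, hM⟩ := exists_abs_leftDeriv_three_le hJ u hS
  refine ⟨2 * M, fun c s hs1 hc g hg ↦ ?_⟩
  set v := ∑ i, c i • u i with hv
  have hneg : ∑ i, (-c i) • u i = (-1 : ℝ) • v := by
    simp [hv, Finset.smul_sum]
  have h₁ := contMDiff_leftDeriv (k := 2) (m := 3) le_rfl (by norm_num) hJ v
  have h₂ := contMDiff_leftDeriv (k := 1) (by norm_num) (by norm_num) h₁ v
  have key := abs_sub_sub_two_mul_deriv_le (M := M * s ^ 3)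
    (hasDerivAt_comp_mul_oneParameter (hJ.mdifferentiable (by norm_num)) g v)
    (hasDerivAt_comp_mul_oneParameter (h₁.mdifferentiable (by norm_num)) g v)
    (hasDerivAt_comp_mul_oneParameter (h₂.mdifferentiable (by norm_num)) g v) fun t ht ↦ by
      refine hM c s hc _ ⟨(g, t • c), ⟨hg, ?_⟩, ?_⟩
      · rw [mem_closedBall_zero_iff, pi_norm_le_iff_of_nonneg zero_le_one]
        intro i
        change ‖(t • c) i‖ ≤ 1
        rw [Pi.smul_apply, smul_eq_mul, norm_mul, Real.norm_eq_abs, Real.norm_eq_abs]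
        exact mul_le_one₀ (abs_le.2 ht) (abs_nonneg _) ((hc i).trans hs1)
      · simp only [Pi.smul_apply, smul_assoc, ← Finset.smul_sum, lieExp_smul, ← hv]
  rw [hneg, lieExp_smul, ← oneParameter_one, mul_assoc]
  simpa only [oneParameter_zero, mul_one] using key

end LeftDeriv

/-! ### Common periods and orthogonality of the sines. -/

section Period

theorem exists_isCommonPeriod {n : ℕ} (w : Fin n → ℚ) : ∃ T, IsCommonPeriod w T := by
  -- Multiplying by all denominators makes each `w i` an integer, so each phase advances by a
  -- multiple of `2π`.
  refine ⟨2 * Real.pi * ∏ i, ((w i).den : ℝ), ?_, fun i τ ↦ ?_⟩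
  · have : ∀ i, (0 : ℝ) < (w i).den := fun i ↦ by exact_mod_cast (w i).den_pos
    have := Finset.prod_pos fun i (_ : i ∈ Finset.univ) ↦ this i
    positivity
  · have hden : ((w i).den : ℝ) ≠ 0 := by exact_mod_cast (w i).den_nz
    have hw : (w i : ℝ) * (w i).den = (w i).num := by exact_mod_cast Rat.mul_den_eq_num (w i)
    have e : (w i : ℝ) * (2 * Real.pi * ∏ j, ((w j).den : ℝ)) =
        (((w i).num * ∏ j ∈ Finset.univ.erase i, ((w j).den : ℤ) : ℤ) : ℝ) * (2 * Real.pi) := by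
      rw [← Finset.mul_prod_erase _ _ (Finset.mem_univ i)]
      push_cast
      rw [← hw]
      ring
    change Real.sin ((w i : ℝ) * (τ + _)) = _
    rw [mul_add, e, Real.sin_add_int_mul_two_pi]

/-- Evaluate periodicity at `π/(2p)`, where the sine equals `1`. -/
theorem cos_mul_period_eq_one {p T : ℝ} (hp : p ≠ 0)
    (h : Function.Periodic (fun τ : ℝ ↦ Real.sin (p * τ)) T) : Real.cos (p * T) = 1 := by
  have h := h (Real.pi / 2 / p)
  simp only [mul_add, mul_div_cancel₀ _ hp, Real.sin_pi_div_two] at h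
  rwa [add_comm, Real.sin_add_pi_div_two] at h

theorem sin_mul_sub_period {p T : ℝ} (h : Function.Periodic (fun τ : ℝ ↦ Real.sin (p * τ)) T)
    (τ : ℝ) : Real.sin (p * (T - τ)) = -Real.sin (p * τ) := by
  have h := h (-τ)
  simp only [neg_add_eq_sub] at h
  rw [h, mul_neg, Real.sin_neg]

theorem integral_cos_mul_eq_zero {m T : ℝ} (hm : m ≠ 0) (h : Real.cos (m * T) = 1) :
    ∫ τ in (0 : ℝ)..T, Real.cos (m * τ) = 0 := by
  rw [intervalIntegral.integral_comp_mul_left (fun x ↦ Real.cos x) hm, integral_cos,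
    Real.sin_eq_zero_iff_cos_eq.2 (Or.inl h)]
  simp

theorem integral_sin_mul_sin {p q T : ℝ} (hp : 0 < p) (hq : 0 < q) (hpT : Real.cos (p * T) = 1)
    (hqT : Real.cos (q * T) = 1) :
    ∫ τ in (0 : ℝ)..T, Real.sin (p * τ) * Real.sin (q * τ) = if p = q then T / 2 else 0 := by
  have sp := Real.sin_eq_zero_iff_cos_eq.2 (Or.inl hpT)
  have sq := Real.sin_eq_zero_iff_cos_eq.2 (Or.inl hqT)
  have e : ∀ τ, Real.sin (p * τ) * Real.sin (q * τ) =
      (Real.cos ((p - q) * τ) - Real.cos ((p + q) * τ)) / 2 := fun τ ↦ by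
    rw [sub_mul, add_mul, Real.cos_sub, Real.cos_add]; ring
  have hadd : ∫ τ in (0 : ℝ)..T, Real.cos ((p + q) * τ) = 0 :=
    integral_cos_mul_eq_zero (by positivity) (by rw [add_mul, Real.cos_add, hpT, hqT, sp, sq]; simp)
  simp only [e, intervalIntegral.integral_div]
  rw [intervalIntegral.integral_sub (Continuous.intervalIntegrable (by fun_prop) _ _)
    (Continuous.intervalIntegrable (by fun_prop) _ _), hadd]
  split_ifs with hpq
  · simp [hpq]
  · rw [integral_cos_mul_eq_zero (sub_ne_zero.2 hpq)
      (by rw [sub_mul, Real.cos_sub, hpT, hqT, sp, sq]; simp)]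
    simp

end Period

/-! ### Averaging and the fourth-order remainder. -/

section Average

variable {E : Type*} [NormedAddCommGroup E] [NormedSpace ℝ E]
  {G : Type*} [TopologicalSpace G] [ChartedSpace E G] [Group G] {n : ℕ}

/-- Expanding the dither by linearity, orthogonality leaves only the term `j = i`, where `sin²` has
mean `1/2`. -/
theorem mean_sin_mul_leftDeriv_dither {J : G → ℝ}
    {b : Module.Basis (Fin n) ℝ (GroupLieAlgebra 𝓘(ℝ, E) G)} {ν : Fin n → ℝ} {T : ℝ}
    (hT : T ≠ 0) (hpos : ∀ i, 0 < ν i)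
    (hinj : Function.Injective ν) (hν : ∀ i, Real.cos (ν i * T) = 1) (a : Fin n → ℝ) (g : G)
    (i : Fin n) :
    T⁻¹ * ∫ τ in (0 : ℝ)..T, a i * Real.sin (ν i * τ) * leftDeriv J (dither b a ν τ) g =
      a i ^ 2 / 2 * leftDeriv J (b i) g := by
  have e : ∀ τ, a i * Real.sin (ν i * τ) * leftDeriv J (dither b a ν τ) g =
      ∑ j, a i * a j * leftDeriv J (b j) g * (Real.sin (ν i * τ) * Real.sin (ν j * τ)) := by
    intro τ
    rw [dither, leftDeriv_sum, Finset.mul_sum]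
    exact Finset.sum_congr rfl fun j _ ↦ by ring
  simp only [e]
  rw [intervalIntegral.integral_finsetSum
    fun j _ ↦ Continuous.intervalIntegrable (by fun_prop) _ _]
  simp only [intervalIntegral.integral_const_mul,
    integral_sin_mul_sin (hpos _) (hpos _) (hν _) (hν _), hinj.eq_iff]
  simp only [mul_ite, mul_zero, Finset.sum_ite_eq, Finset.mem_univ, if_true]
  field_simp

variable [FiniteDimensional ℝ E] [LieGroup 𝓘(ℝ, E) ∞ G] [T2Space G]

/-- The average over `[0, T]` of the `i`-th component of the dither times the perturbed cost. -/
noncomputable def demodulatedMean (J : G → ℝ)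
    (b : Module.Basis (Fin n) ℝ (GroupLieAlgebra 𝓘(ℝ, E) G)) (ν : Fin n → ℝ) (T : ℝ)
    (a : Fin n → ℝ) (g : G) (i : Fin n) : ℝ :=
  T⁻¹ * ∫ τ in (0 : ℝ)..T, a i * Real.sin (ν i * τ) * J (g * lieExp (dither b a ν τ))

variable {J : G → ℝ} {b : Module.Basis (Fin n) ℝ (GroupLieAlgebra 𝓘(ℝ, E) G)}

theorem continuous_comp_dither (hJ : Continuous J) (a ν : Fin n → ℝ) (g : G) :
    Continuous fun τ ↦ J (g * lieExp (dither b a ν τ)) := by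
  have : ContinuousMul G := continuousMul_of_contMDiffMul 𝓘(ℝ, E) ∞
  refine hJ.comp (continuous_const.mul ?_)
  exact (continuous_lieExp_sum b).comp (f := fun τ j ↦ a j * Real.sin (ν j * τ)) (by fun_prop)

theorem continuous_sin_mul_comp_dither (hJ : Continuous J) (x p : ℝ) (a ν : Fin n → ℝ) (g : G) :
    Continuous fun τ ↦ x * Real.sin (p * τ) * J (g * lieExp (dither b a ν τ)) :=
  Continuous.mul (by fun_prop) (continuous_comp_dither hJ a ν g)

theorem continuous_seekingField (hJ : Continuous J) (a ν : Fin n → ℝ) (g : G) :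
    Continuous (seekingField J b a ν g) := by
  change Continuous fun τ ↦ -∑ i, (a i * Real.sin (ν i * τ) *
    J (g * lieExp (dither b a ν τ))) • leftInvariant g (b i)
  exact (continuous_finsetSum _ fun i _ ↦
    (continuous_sin_mul_comp_dither hJ _ _ a ν g).smul continuous_const).neg

theorem seekingField_rescale (a ν : Fin n → ℝ) (Ω : ℝ) (g : G) (t : ℝ) :
    seekingField J b a (fun i ↦ Ω * ν i) g t = seekingField J b a ν g (Ω * t) := by
  have e : ∀ i, Ω * ν i * t = ν i * (Ω * t) := fun i ↦ by ring
  simp only [seekingField, dither, e]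

theorem timeScaled_seekingField (a ν : Fin n → ℝ) {Ω : ℝ} (hΩ : Ω ≠ 0) (g : G) (τ : ℝ) :
    timeScaled Ω (seekingField J b a fun i ↦ Ω * ν i) g τ = Ω⁻¹ • seekingField J b a ν g τ := by
  rw [timeScaled, seekingField_rescale, mul_div_cancel₀ _ hΩ]

theorem periodic_seekingField {ν : Fin n → ℝ} {T : ℝ}
    (hν : ∀ i, Function.Periodic (fun τ : ℝ ↦ Real.sin (ν i * τ)) T) (a : Fin n → ℝ) (g : G) :
    Function.Periodic (seekingField J b a ν g) T := fun τ ↦ by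
  have e : ∀ i, Real.sin (ν i * (τ + T)) = Real.sin (ν i * τ) := fun i ↦ hν i τ
  simp only [seekingField, dither, e]

theorem averagedField_seekingField (hJ : Continuous J) (a ν : Fin n → ℝ) (T : ℝ) (g : G) :
    (averagedField (seekingField J b a ν) T g : E) =
      -∑ i, demodulatedMean J b ν T a g i • leftInvariant g (b i) := by
  have hc (i) : Continuous fun τ ↦ (a i * Real.sin (ν i * τ) *
      J (g * lieExp (dither b a ν τ))) • leftInvariant g (b i) :=
    (continuous_sin_mul_comp_dither hJ _ _ a ν g).smul continuous_const
  change T⁻¹ • ∫ τ in (0 : ℝ)..T, -∑ i, (a i * Real.sin (ν i * τ) *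
    J (g * lieExp (dither b a ν τ))) • leftInvariant g (b i) = _
  rw [intervalIntegral.integral_neg, intervalIntegral.integral_finsetSum
    fun i _ ↦ (hc i).intervalIntegrable _ _]
  simp only [intervalIntegral.integral_smul_const, smul_neg, Finset.smul_sum, smul_smul,
    demodulatedMean]

theorem averagedField_timeScaled (a ν : Fin n → ℝ) {Ω : ℝ} (hΩ : Ω ≠ 0) (T : ℝ) (g : G) :
    averagedField (timeScaled Ω (seekingField J b a fun i ↦ Ω * ν i)) T g =
      Ω⁻¹ • averagedField (seekingField J b a ν) T g := by
  let F : ℝ → E := seekingField J b a ν g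
  have e : timeScaled Ω (seekingField J b a fun i ↦ Ω * ν i) g = fun τ ↦ Ω⁻¹ • F τ :=
    funext fun τ ↦ timeScaled_seekingField a ν hΩ g τ
  rw [averagedField, e]
  change T⁻¹ • ∫ τ in (0 : ℝ)..T, Ω⁻¹ • F τ = Ω⁻¹ • T⁻¹ • ∫ τ in (0 : ℝ)..T, F τ
  rw [intervalIntegral.integral_smul, smul_comm]

theorem averagedField_rescale (a ν : Fin n → ℝ) {Ω : ℝ} (hΩ : Ω ≠ 0) (T : ℝ) (g : G) :
    averagedField (seekingField J b a fun i ↦ Ω * ν i) (T / Ω) g =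
      averagedField (seekingField J b a ν) T g := by
  let F : ℝ → E := seekingField J b a ν g
  have e : seekingField J b a (fun i ↦ Ω * ν i) g = fun τ ↦ F (Ω * τ) :=
    funext fun τ ↦ seekingField_rescale a ν Ω g τ
  rw [averagedField, e]
  change (T / Ω)⁻¹ • ∫ τ in (0 : ℝ)..(T / Ω), F (Ω * τ) = T⁻¹ • ∫ τ in (0 : ℝ)..T, F τ
  rw [intervalIntegral.integral_comp_mul_left F hΩ, smul_smul, mul_zero, mul_div_cancel₀ _ hΩ,
    inv_div, div_mul_eq_mul_div, mul_inv_cancel₀ hΩ, one_div]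

/-- The mean of a demodulated cost component is the mean of the odd part of the cost. -/
theorem demodulatedMean_eq_odd_part (hJ : Continuous J) {ν : Fin n → ℝ} {T : ℝ}
    (hν : ∀ i, Function.Periodic (fun τ : ℝ ↦ Real.sin (ν i * τ)) T) (a : Fin n → ℝ) (g : G)
    (i : Fin n) :
    2 * demodulatedMean J b ν T a g i = T⁻¹ * ∫ τ in (0 : ℝ)..T, a i * Real.sin (ν i * τ) *
      (J (g * lieExp (dither b a ν τ)) - J (g * lieExp (dither b (fun j ↦ -a j) ν τ))) := by
  have hΦ := continuous_sin_mul_comp_dither (b := b) hJ (a i) (ν i) a ν g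
  have hΦ' := continuous_sin_mul_comp_dither (b := b) hJ (a i) (ν i) (fun j ↦ -a j) ν g
  have hrefl : ∫ τ in (0 : ℝ)..T, a i * Real.sin (ν i * τ) * J (g * lieExp (dither b a ν τ)) =
      ∫ τ in (0 : ℝ)..T,
        -(a i * Real.sin (ν i * τ) * J (g * lieExp (dither b (fun j ↦ -a j) ν τ))) := by
    -- Substitution `τ ↦ T - τ`: it negates both the demodulating sine and the whole dither.
    have h := intervalIntegral.integral_comp_sub_left (a := 0) (b := T)
      (fun τ ↦ a i * Real.sin (ν i * τ) * J (g * lieExp (dither b a ν τ))) T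
    rw [sub_self, sub_zero] at h
    rw [← h]
    refine intervalIntegral.integral_congr fun τ _ ↦ ?_
    have e : dither b a ν (T - τ) = dither b (fun j ↦ -a j) ν τ := by
      simp only [dither, sin_mul_sub_period (hν _), mul_neg, neg_mul]
    simp only [e, sin_mul_sub_period (hν i)]
    ring
  simp only [mul_sub]
  rw [intervalIntegral.integral_sub (hΦ.intervalIntegrable _ _) (hΦ'.intervalIntegrable _ _),
    demodulatedMean]
  rw [intervalIntegral.integral_neg] at hrefl
  linear_combination T⁻¹ * hrefl

/-- The difference is minus half the mean of the dither coefficient, at most `s`, times the cubic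
remainder `D`, at most `M s³`; this gives the constant `M / 2`. -/
theorem exists_abs_sub_demodulatedMean_le (hJ : ContMDiff 𝓘(ℝ, E) 𝓘(ℝ, ℝ) 3 J) {ν : Fin n → ℝ}
    {T : ℝ} (hT : 0 < T) (hpos : ∀ i, 0 < ν i) (hinj : Function.Injective ν)
    (hν : ∀ i, Function.Periodic (fun τ : ℝ ↦ Real.sin (ν i * τ)) T) {K : Set G}
    (hK : IsCompact K) :
    ∃ C : ℝ, ∀ a : Fin n → ℝ, ∀ s ≤ 1, (∀ i, |a i| ≤ s) → ∀ g ∈ K, ∀ i,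
      |a i ^ 2 / 2 * leftDeriv J (b i) g - demodulatedMean J b ν T a g i| ≤ C * s ^ 4 := by
  obtain ⟨M, hM⟩ := exists_abs_odd_part_le hJ b hK
  refine ⟨M / 2, fun a s hs ha g hg i ↦ ?_⟩
  have hs0 : 0 ≤ s := (abs_nonneg _).trans (ha i)
  set c : ℝ → Fin n → ℝ := fun τ j ↦ a j * Real.sin (ν j * τ)
  have hc (τ : ℝ) (j : Fin n) : |c τ j| ≤ s := by
    rw [abs_mul]
    exact (mul_le_of_le_one_right (abs_nonneg _) (Real.abs_sin_le_one _)).trans (ha j)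
  have hodd : Continuous fun τ ↦ a i * Real.sin (ν i * τ) * (J (g * lieExp (dither b a ν τ)) -
      J (g * lieExp (dither b (fun j ↦ -a j) ν τ))) :=
    Continuous.mul (by fun_prop) ((continuous_comp_dither hJ.continuous a ν g).sub
      (continuous_comp_dither hJ.continuous (fun j ↦ -a j) ν g))
  have hL : Continuous fun τ ↦ leftDeriv J (dither b a ν τ) g := by
    simp only [dither, leftDeriv_sum]
    fun_prop
  set D : ℝ → ℝ := fun τ ↦ J (g * lieExp (dither b a ν τ)) -
    J (g * lieExp (dither b (fun j ↦ -a j) ν τ)) - 2 * leftDeriv J (dither b a ν τ) g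
  have hDle (τ : ℝ) : |D τ| ≤ M * s ^ 3 := by
    have h := hM (c τ) s hs (hc τ) g hg
    simpa only [c, D, dither, neg_mul] using h
  have hrem : a i ^ 2 / 2 * leftDeriv J (b i) g - demodulatedMean J b ν T a g i =
      -(T⁻¹ / 2 * ∫ τ in (0 : ℝ)..T, c τ i * D τ) := by
    have h1 := demodulatedMean_eq_odd_part (b := b) hJ.continuous hν a g i
    have h2 := mean_sin_mul_leftDeriv_dither (J := J) (b := b) hT.ne' hpos hinj
      (fun i ↦ cos_mul_period_eq_one (hpos i).ne' (hν i)) a g i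
    have e : ∀ τ, c τ i * D τ = a i * Real.sin (ν i * τ) *
        (J (g * lieExp (dither b a ν τ)) - J (g * lieExp (dither b (fun j ↦ -a j) ν τ))) -
        2 * (a i * Real.sin (ν i * τ) * leftDeriv J (dither b a ν τ) g) := fun τ ↦ by
      simp only [c, D]; ring
    simp only [e]
    rw [intervalIntegral.integral_sub (hodd.intervalIntegrable _ _)
      (Continuous.intervalIntegrable (by fun_prop) _ _), intervalIntegral.integral_const_mul]
    linear_combination -h2 - h1 / 2
  have hint : |∫ τ in (0 : ℝ)..T, c τ i * D τ| ≤ s * (M * s ^ 3) * T := by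
    have h := intervalIntegral.norm_integral_le_of_norm_le_const (a := 0) (b := T)
      (f := fun τ ↦ c τ i * D τ) (C := s * (M * s ^ 3)) fun τ _ ↦ by
        rw [norm_mul]
        exact mul_le_mul (hc τ i) (hDle τ) (abs_nonneg _) hs0
    simpa [abs_of_pos hT] using h
  rw [hrem, abs_neg, abs_mul, abs_of_pos (by positivity)]
  calc T⁻¹ / 2 * |∫ τ in (0 : ℝ)..T, c τ i * D τ| ≤ T⁻¹ / 2 * (s * (M * s ^ 3) * T) := by gcongr
    _ = M / 2 * s ^ 4 := by field_simp

end Average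

end ExtremumSeeking

/-! ### The averaged extremum seeking field. -/

open ExtremumSeeking in
theorem mainTheorem7
    {E : Type*} [NormedAddCommGroup E] [NormedSpace ℝ E] [FiniteDimensional ℝ E]
    {G : Type*} [TopologicalSpace G] [ChartedSpace E G] [Group G] [LieGroup 𝓘(ℝ, E) ∞ G]
    [T2Space G] {n : ℕ} (b : Module.Basis (Fin n) ℝ (GroupLieAlgebra 𝓘(ℝ, E) G))
    (J : G → ℝ) (gstar : G) (hJ : CostAssumption (E := E) J gstar)
    (w : Fin n → ℚ) (hw : FrequencyAssumption w) :
    (∃ T, IsCommonPeriod w T) ∧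
    ∀ T, IsCommonPeriod w T →
      (∀ (a : Fin n → ℝ) (Ω : ℝ), 0 < Ω → ∀ g : G,
        Function.Periodic (timeScaled Ω (seekingField J b a (fun i ↦ Ω * w i)) g) T ∧
        Continuous (timeScaled Ω (seekingField J b a (fun i ↦ Ω * w i)) g)) ∧
      ∃ h : (Fin n → ℝ) → G → Fin n → ℝ,
        (∀ K : Set G, IsCompact K → ∃ C : ℝ, ∃ r > 0, ∀ a : Fin n → ℝ,
          (∀ i, 0 < a i ∧ a i ≤ r) → ∀ g ∈ K, ∀ i, |h a g i| ≤ C * (⨆ j, a j) ^ 4) ∧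
        ∀ a : Fin n → ℝ, (∀ i, 0 < a i) → ∀ Ω : ℝ, 0 < Ω → ∀ g : G,
          averagedField (timeScaled Ω (seekingField J b a (fun i ↦ Ω * w i))) T g =
            -(Ω⁻¹ • ∑ i, (a i ^ 2 / 2 * leftDeriv J (b i) g) • mulInvariantVectorField (b i) g)
              + Ω⁻¹ • ∑ i, h a g i • mulInvariantVectorField (b i) g ∧
          averagedField (seekingField J b a (fun i ↦ Ω * w i)) (T / Ω) g =
            -(∑ i, (a i ^ 2 / 2 * leftDeriv J (b i) g) • mulInvariantVectorField (b i) g)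
              + ∑ i, h a g i • mulInvariantVectorField (b i) g ∧
          ∑ i, a i ^ 2 / 2 * leftDeriv J (b i) g = leftDeriv J (∑ i, a i ^ 2 • b i) g / 2 := by
  refine ⟨exists_isCommonPeriod w, fun T hT ↦ ⟨fun a Ω hΩ g ↦ ?_, ?_⟩⟩
  · have e : timeScaled Ω (seekingField J b a (fun i ↦ Ω * w i)) g =
        fun τ ↦ Ω⁻¹ • seekingField J b a (fun i ↦ (w i : ℝ)) g τ :=
      funext fun τ ↦ timeScaled_seekingField a (fun i ↦ (w i : ℝ)) hΩ.ne' g τ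
    rw [e]
    refine ⟨fun τ ↦ congrArg (Ω⁻¹ • ·) (periodic_seekingField hT.2 a g τ), ?_⟩
    exact (continuous_const_smul (T := E) Ω⁻¹).comp
      (continuous_seekingField hJ.smooth.continuous a (fun i ↦ (w i : ℝ)) g)
  · have havg (a : Fin n → ℝ) (g : G) :
        averagedField (seekingField J b a fun i ↦ (w i : ℝ)) T g =
          -(∑ i, (a i ^ 2 / 2 * leftDeriv J (b i) g) • mulInvariantVectorField (b i) g)
            + ∑ i, (a i ^ 2 / 2 * leftDeriv J (b i) g -
              demodulatedMean J b (fun i ↦ (w i : ℝ)) T a g i) •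
                mulInvariantVectorField (b i) g := by
      refine (averagedField_seekingField hJ.smooth.continuous a _ T g).trans ?_
      change _ = -(∑ i, (a i ^ 2 / 2 * leftDeriv J (b i) g) • leftInvariant g (b i))
        + ∑ i, (a i ^ 2 / 2 * leftDeriv J (b i) g -
          demodulatedMean J b (fun i ↦ (w i : ℝ)) T a g i) • leftInvariant g (b i)
      simp only [sub_smul, Finset.sum_sub_distrib]
      abel
    -- The remainder is defined as the exact difference, in terms of the normalized frequencies, so
    -- it does not involve `Ω`.
    refine ⟨fun a g i ↦ a i ^ 2 / 2 * leftDeriv J (b i) g -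
      demodulatedMean J b (fun i ↦ (w i : ℝ)) T a g i, fun K hK ↦ ?_, fun a _ Ω hΩ g ↦ ⟨?_, ?_, ?_⟩⟩
    · obtain ⟨C, hC⟩ := exists_abs_sub_demodulatedMean_le (b := b) (ν := fun i ↦ (w i : ℝ))
        (hJ.smooth.of_le (WithTop.coe_le_coe.2 le_top)) hT.1 (fun i ↦ by exact_mod_cast hw.pos i)
        (fun i j hij ↦ by_contra fun hne ↦ hw.ne i j hne (Rat.cast_injective hij)) hT.2 hK
      -- The radius `1` ensures that the largest amplitude meets the condition `s ≤ 1`.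
      refine ⟨C, 1, one_pos, fun a ha g hg i ↦ ?_⟩
      have : Nonempty (Fin n) := ⟨i⟩
      refine hC a _ (ciSup_le fun j ↦ (ha j).2) (fun j ↦ ?_) g hg i
      rw [abs_of_pos (ha j).1]
      exact le_ciSup (Set.finite_range a).bddAbove j
    · refine (averagedField_timeScaled a (fun i ↦ (w i : ℝ)) hΩ.ne' T g).trans ?_
      rw [havg, smul_add, smul_neg]
    · exact (averagedField_rescale a (fun i ↦ (w i : ℝ)) hΩ.ne' T g).trans (havg a g)
    · rw [leftDeriv_sum, Finset.sum_div]
      exact Finset.sum_congr rfl fun i _ ↦ by ring
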